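/- Let $n\ge 3$ be an odd integer, $m=\varphi(n)/2$, and $S_n=\{a\in\mathbb Z : 1\le a<n/2,\ \gcd(a,n)=1\}$. Let $$D_n=\Bigl(\sec\tfrac{2jk\pi}{n}\Bigr)_{j,k\in S_n}.$$ Then $$\det D_n=\varepsilon(n)\,(-1)^{\frac{(n-1)m}{2}}\Bigl(\frac{2n}{\pi}\Bigr)^m\prod_{\chi}\chi(4)\,L(1,\chi\psi),$$ where $\chi$ runs over all even (i.e. $\chi(-1)=1$) complex Dirichlet characters modulo $n$, primitive or not, $\psi$ is the nontrivial Dirichlet character modulo $4$, $\chi\psi$ is regarded as a Dirichlet character modulo $4n$, and $L(s,\chi\psi)$ is its Dirichlet $L$-function. The sign $\varepsilon(n)$ is given, in terms of the factorization $n=\prod_{i=1}^r p_i^{e_i}$ into powers of distinct primes ($e_i\ge1$), by $$\varepsilon(n)=\begin{cases}-1 & \text{if } r=1 \text{ and } \bigl(p_1\equiv 1 \pmod 8 \text{ or } p_1\equiv 4e_1+3\pmod 8\bigr),\\ -1 & \text{if } r=2 \text{ and } p_1+p_2\equiv 0\pmod 4,\\ 1 & \text{otherwise.}\end{cases}$$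 -/

import Mathlib

/-- The set `S_n` of integers `1 ≤ a < n / 2` coprime to `n`. -/
def halfUnits (n : ℕ) : Finset ℕ :=
  (Finset.range n).filter (fun a => 1 ≤ a ∧ 2 * a < n ∧ Nat.Coprime a n)

/-- The real secant function. -/
noncomputable def realSec (x : ℝ) : ℝ := 1 / Real.cos x

/-- The matrix `D_n`, with entries `sec (2jkπ/n)` and rows and columns indexed by `S_n`. -/
noncomputable def secMatrix (n : ℕ) : Matrix (halfUnits n) (halfUnits n) ℝ :=
  Matrix.of fun j k => realSec (2 * ((j : ℕ) : ℝ) * ((k : ℕ) : ℝ) * Real.pi / (n : ℝ))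

open Classical in
/-- The sign `ε(n)`, for odd `n ≥ 3`. The first condition is the case of a single prime factor,
`n = p ^ e`; the second is the case of exactly two distinct prime factors `p`, `q`. -/
noncomputable def secSign (n : ℕ) : ℤ :=
  if ∃ p e : ℕ, p.Prime ∧ 1 ≤ e ∧ n = p ^ e ∧ (p ≡ 1 [MOD 8] ∨ p ≡ 4 * e + 3 [MOD 8]) then -1
  else if ∃ p q : ℕ, p ≠ q ∧ n.primeFactors = {p, q} ∧ p + q ≡ 0 [MOD 4] then -1
  else 1

/-- The nontrivial Dirichlet character `ψ` modulo `4`, with complex values. -/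
noncomputable def psiFour : DirichletCharacter ℂ 4 :=
  ZMod.χ₄.ringHomComp (Int.castRingHom ℂ)

/-- The product `χψ`, as a Dirichlet character modulo `4n`. -/
noncomputable def mulPsi {n : ℕ} (χ : DirichletCharacter ℂ n) : DirichletCharacter ℂ (4 * n) :=
  χ.changeLevel (Dvd.intro_left 4 rfl) * psiFour.changeLevel (Dvd.intro n rfl)

open Classical in
/-- The even Dirichlet characters modulo `n`. -/
noncomputable def evenCharacters (n : ℕ) [NeZero n] : Finset (DirichletCharacter ℂ n) :=
  Finset.univ.filter fun χ => χ.Even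

/-!
Let `G = (ℤ/nℤ)ˣ / {±1}`. The set `S_n` represents the elements of `G`, and `a ↦ sec (2aπ/n)`
descends to a function `f` on `G`, so the matrix in question is the multiplication table
`(f (g * h))`. Multiplying it by the character table `(χ g)` of `G`, whose characters are the even
characters modulo `n`, gives `diag (λ_χ)` times the character table with its columns permuted by
inversion, where `λ_χ = ∑ g, χ g * f g`. The character table is invertible by Dedekind's theorem, so
the determinant is the sign of the permutation `g ↦ g⁻¹` of `G` times `∏ λ_χ`
(`Matrix.det_mul_table_eq_sign_mul_prod`, `secMatrix_det_eq`).

For `χ` even, `χψ` is odd, and the odd Hurwitz zeta function at `1` is `π/2 * cot (πa)`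
(`hurwitzZetaOdd_apply_one`), so `L(1, χψ)` is a sum of values `χψ(j) cot (πj/(4n))` over `j` modulo
`4n`. Writing `j = n a + 4 c` and adding up the terms `a = 1` and `a = 3` turns the two cotangents
into a secant, so that `L(1, χψ) = (π/(2n)) (-1) ^ ((n-1)/2) χ(4) λ_χ` (`mulPsi_LFunction_one`). Since
inversion permutes the even characters, `(∏ χ(4)) ^ 2 = 1`, which puts the factor `χ(4)` on the
other side.

Inversion on `G` has sign `(-1) ^ ((|G| - t)/2)`, where `t` counts the `g` with `g ^ 2 = 1`. Here
`|G| = φ(n)/2`, and `2t` is the number of square roots of `1` modulo `n` plus the number of square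
roots of `-1`. Both numbers are multiplicative in `n`: the former is `2 ^ r`, the latter is `2 ^ r` if
all prime factors of `n` are `1` modulo `4` and `0` otherwise. Comparing residues modulo `4` for
`r = 1`, `r = 2` and `r ≥ 3` gives `ε(n)` (`secSign_eq_sign`).
-/

/-! ### The group determinant of a commutative group -/

/-- The determinant of `(f (g * h))` in terms of the character sums of `f`, for a full family `χ` of
characters of `G`. -/
theorem Matrix.det_mul_table_eq_sign_mul_prod {G ι : Type*} [CommGroup G] [Fintype G]
    [DecidableEq G] [Fintype ι] (f : G → ℂ) (χ : ι → G →* ℂ) (hχ : Function.Injective χ)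
    (hcard : Fintype.card ι = Fintype.card G) :
    (Matrix.of fun g h : G => f (g * h)).det =
      ((Equiv.Perm.sign (Equiv.inv G) : ℤ) : ℂ) * ∏ i, ∑ g, χ i g * f g := by
  classical
  let e : G ≃ ι := (Fintype.equivOfCardEq hcard).symm
  let X : Matrix G G ℂ := Matrix.of fun i g => χ (e i) g
  have hX : X.det ≠ 0 := by
    have hli : LinearIndependent ℂ X.row :=
      (linearIndependent_monoidHom G ℂ).comp (fun i => χ (e i)) (hχ.comp e.injective)
    exact ((Matrix.isUnit_iff_isUnit_det X).mp
      (Matrix.linearIndependent_rows_iff_isUnit.mp hli)).ne_zero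
  have hmul : X * (Matrix.of fun g h : G => f (g * h)) =
      Matrix.diagonal (fun i => ∑ g, χ (e i) g * f g) * X.submatrix id (Equiv.inv G) := by
    ext i k
    rw [Matrix.diagonal_mul, Matrix.mul_apply, Finset.sum_mul]
    refine Fintype.sum_equiv (Equiv.mulRight k) _ _ fun g => ?_
    have : χ (e i) k * χ (e i) k⁻¹ = 1 := by rw [← map_mul, mul_inv_cancel, map_one]
    simp only [X, Matrix.of_apply, Matrix.submatrix_apply, id, Equiv.coe_mulRight, map_mul,
      Equiv.inv_apply]
    linear_combination (-(χ (e i) g * f (g * k))) * this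
  have hdet := congrArg Matrix.det hmul
  rw [Matrix.det_mul, Matrix.det_mul, Matrix.det_diagonal, Matrix.det_permute',
    Fintype.prod_equiv e _ (fun i => ∑ g, χ i g * f g) fun _ => rfl] at hdet
  apply mul_left_cancel₀ hX
  rw [hdet]
  ring

theorem Equiv.Perm.sign_inv_group {G : Type*} [CommGroup G] [Fintype G] [DecidableEq G] :
    Equiv.Perm.sign (Equiv.inv G) =
      (-1) ^ ((Fintype.card G - Fintype.card {g : G // g ^ 2 = 1}) / 2) := by
  have hsq : (Equiv.inv G : Equiv.Perm G) ^ 2 = 1 := by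
    ext g
    simp [sq]
  rw [Equiv.Perm.sign_of_pow_two_eq_one hsq]
  congr 3
  refine Fintype.card_congr (Equiv.subtypeEquivRight fun g => ?_)
  rw [Function.mem_fixedPoints, Function.IsFixedPt, Equiv.inv_apply, inv_eq_iff_mul_eq_one, sq]

/-- Summing over a finite group a function that factors through a quotient. -/
theorem QuotientGroup.sum_mk_eq_nsmul {G M : Type*} [Group G] [Fintype G] (H : Subgroup G)
    [Fintype (G ⧸ H)] [AddCommMonoid M] (F : G ⧸ H → M) :
    ∑ g : G, F g = Nat.card H • ∑ q : G ⧸ H, F q := by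
  classical
  have := Fintype.ofFinite H
  rw [← Finset.sum_fiberwise (s := Finset.univ) (g := fun g : G => (g : G ⧸ H)), Finset.smul_sum]
  refine Finset.sum_congr rfl fun q _ => ?_
  rw [Finset.sum_congr rfl (g := fun _ => F q) fun g hg => by rw [(Finset.mem_filter.mp hg).2],
    Finset.sum_const]
  congr 1
  obtain ⟨g, rfl⟩ := QuotientGroup.mk_surjective q
  rw [Nat.card_eq_fintype_card, ← Finset.card_univ]
  symm
  refine Finset.card_bij (fun h _ => g * h) (fun h _ => ?_) (fun a _ b _ hab => ?_) fun b hb => ?_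
  · simp
  · simpa using hab
  · refine ⟨⟨g⁻¹ * b, QuotientGroup.eq.mp (Finset.mem_filter.mp hb).2.symm⟩, Finset.mem_univ _, ?_⟩
    simp

/-! ### The odd Hurwitz zeta function at `1` -/

/-- For `s ∈ [1, 2]` and `x, y ∈ [n, n + 1]`, both `x ^ (-s)` and `y ^ (-s)` lie in an interval of
length at most `2 / n ^ 2`. -/
theorem abs_one_div_rpow_sub_le {n x y s : ℝ} (hn : 0 < n) (hx : n ≤ x) (hx' : x ≤ n + 1)
    (hy : n ≤ y) (hy' : y ≤ n + 1) (hs : 1 ≤ s) (hs' : s ≤ 2) :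
    |1 / x ^ s - 1 / y ^ s| ≤ 2 / n ^ 2 := by
  have hn1 : (0 : ℝ) < n + 1 := by linarith
  have bounds : ∀ z : ℝ, n ≤ z → z ≤ n + 1 → 1 / (n + 1) ^ s ≤ 1 / z ^ s ∧ 1 / z ^ s ≤ 1 / n ^ s := by
    intro z h1 h2
    have hz : 0 < z := by linarith
    exact ⟨one_div_le_one_div_of_le (Real.rpow_pos_of_pos hz s)
      (Real.rpow_le_rpow hz.le h2 (by linarith)),
      one_div_le_one_div_of_le (Real.rpow_pos_of_pos hn s)
      (Real.rpow_le_rpow hn.le h1 (by linarith))⟩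
  have key : 1 / n ^ s - 1 / (n + 1) ^ s ≤ 2 / n ^ 2 := by
    have h1 : 1 / (n + 1) ^ s = 1 / n ^ s * (n / (n + 1)) ^ s := by
      rw [Real.div_rpow hn.le hn1.le]
      have := (Real.rpow_pos_of_pos hn s).ne'
      field_simp
    have h2 : (n / (n + 1)) ^ (2 : ℕ) ≤ (n / (n + 1)) ^ s := by
      rw [← Real.rpow_natCast]
      exact Real.rpow_le_rpow_of_exponent_ge (by positivity)
        (by rw [div_le_one hn1]; linarith) (by exact_mod_cast hs')
    have h3 : 1 - (n / (n + 1)) ^ (2 : ℕ) ≤ 2 / (n + 1) := by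
      have : 1 - (n / (n + 1)) ^ (2 : ℕ) = 2 / (n + 1) - 1 / (n + 1) ^ 2 := by
        field_simp
        ring
      rw [this]
      linarith [show (0 : ℝ) ≤ 1 / (n + 1) ^ 2 by positivity]
    rcases le_total 1 n with h | h
    · have h4 : 1 / n ^ s ≤ 1 / n := by
        apply one_div_le_one_div_of_le hn
        simpa using Real.rpow_le_rpow_of_exponent_le h hs
      calc 1 / n ^ s - 1 / (n + 1) ^ s = 1 / n ^ s * (1 - (n / (n + 1)) ^ s) := by rw [h1]; ring
        _ ≤ 1 / n ^ s * (2 / (n + 1)) := by gcongr; linarith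
        _ ≤ 1 / n * (2 / n) := by gcongr; linarith
        _ = 2 / n ^ 2 := by ring
    · have h4 : 1 / n ^ s ≤ 1 / n ^ 2 := by
        apply one_div_le_one_div_of_le (by positivity)
        rw [← Real.rpow_natCast]
        exact Real.rpow_le_rpow_of_exponent_ge hn h (by exact_mod_cast hs')
      have h5 : (0 : ℝ) ≤ 1 / (n + 1) ^ s := by positivity
      have h6 : (0 : ℝ) ≤ 1 / n ^ 2 := by positivity
      calc 1 / n ^ s - 1 / (n + 1) ^ s ≤ 2 * (1 / n ^ 2) := by linarith
        _ = 2 / n ^ 2 := by ring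
  obtain ⟨a1, a2⟩ := bounds x hx hx'
  obtain ⟨b1, b2⟩ := bounds y hy hy'
  rw [abs_le]
  constructor <;> linarith

/-- This differs from the Mittag-Leffler expansion of the cotangent by the telescoping series
`∑ (1 / (n + a) - 1 / (n + 1 + a)) = 1 / a`. -/
theorem hasSum_one_div_sub_one_div_eq_cot {a : ℝ} (ha : 0 < a) (ha' : a < 1) :
    HasSum (fun n : ℕ => 1 / (n + a : ℂ) - 1 / (n + 1 - a : ℂ))
      (Real.pi * Complex.cot (Real.pi * a)) := by
  have hz : (a : ℂ) ∈ Complex.integerComplement := by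
    rw [Complex.mem_integerComplement_iff]
    rintro ⟨k, hk⟩
    have hk' : (k : ℝ) = a := by exact_mod_cast hk
    have h1 : (0 : ℤ) < k := by exact_mod_cast hk' ▸ ha
    have h2 : k < 1 := by exact_mod_cast hk' ▸ ha'
    omega
  have hpos : ∀ n : ℕ, (n + a : ℂ) ≠ 0 := fun n => by
    exact_mod_cast (by positivity : (n + a : ℝ) ≠ 0)
  have hcot := (summable_cotTerm hz).hasSum
  rw [← cot_series_rep' hz] at hcot
  have hsummable : Summable fun n : ℕ => 1 / (n + a : ℂ) - 1 / ((n + 1 : ℕ) + a : ℂ) := by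
    have h2 : Summable fun n : ℕ => 1 / (n + a : ℝ) ^ 2 := by
      rw [← summable_nat_add_iff 1]
      refine Summable.of_nonneg_of_le (fun n => by positivity) (fun n => ?_)
        ((summable_nat_add_iff 1).mpr (Real.summable_one_div_nat_pow.mpr one_lt_two))
      apply one_div_le_one_div_of_le (by positivity)
      gcongr
      linarith
    refine Summable.of_norm_bounded h2 fun n => ?_
    have : 1 / (n + a : ℂ) - 1 / ((n + 1 : ℕ) + a : ℂ) =
        ((1 / ((n + a) * (n + 1 + a)) : ℝ) : ℂ) := by
      have h1 := hpos n
      have h2 := hpos (n + 1)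
      push_cast at h2 ⊢
      field_simp
      ring
    rw [this, Complex.norm_real, Real.norm_of_nonneg (by positivity), sq]
    apply one_div_le_one_div_of_le (by positivity)
    gcongr
    linarith
  have htel : HasSum (fun n : ℕ => 1 / (n + a : ℂ) - 1 / ((n + 1 : ℕ) + a : ℂ)) (1 / a) := by
    rw [hsummable.hasSum_iff_tendsto_nat]
    simp_rw [Finset.sum_range_sub' fun n : ℕ => 1 / (n + a : ℂ)]
    have h0 : Filter.Tendsto (fun n : ℕ => 1 / (n + a : ℂ)) Filter.atTop (nhds 0) := by
      have hr : Filter.Tendsto (fun n : ℕ => 1 / (n + a : ℝ)) Filter.atTop (nhds 0) := by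
        simp_rw [one_div]
        exact (Filter.tendsto_atTop_add_const_right _ a
          tendsto_natCast_atTop_atTop).inv_tendsto_atTop
      have := (Complex.continuous_ofReal.tendsto 0).comp hr
      refine this.congr fun n => ?_
      simp
    simpa using h0.const_sub (1 / (a : ℂ))
  have := hcot.add htel
  rw [sub_add_cancel] at this
  refine this.congr_fun fun n => ?_
  rw [cotTerm, ← neg_sub ((n : ℂ) + 1) (a : ℂ), one_div_neg_eq_neg_one_div]
  push_cast
  rw [add_comm (a : ℂ)]
  ring

/-- The Dirichlet series for `s > 1`, with the terms at `n + a` and `n + 1 - a` paired, is dominated by a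
summable sequence on `(1, 2)`; its limit as `s → 1` is a rearranged cotangent series. -/
theorem hurwitzZetaOdd_apply_one {a : ℝ} (ha : 0 < a) (ha' : a < 1) :
    HurwitzZeta.hurwitzZetaOdd a 1 = Real.pi / 2 * Complex.cot (Real.pi * a) := by
  let f : ℝ → ℕ → ℂ := fun s n => (1 / (n + a : ℂ) ^ (s : ℂ) - 1 / (n + 1 - a : ℂ) ^ (s : ℂ)) / 2
  let g : ℕ → ℂ := fun n => (1 / (n + a : ℂ) - 1 / (n + 1 - a : ℂ)) / 2
  have hpos : ∀ n : ℕ, (0 : ℝ) < n + a := fun n => by positivity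
  have hpos' : ∀ n : ℕ, (0 : ℝ) < n + 1 - a := fun n => by
    have : (0 : ℝ) ≤ n := n.cast_nonneg
    linarith
  have hfreal : ∀ s n, f s n = (((1 / (n + a) ^ s - 1 / (n + 1 - a) ^ s) / 2 : ℝ) : ℂ) := by
    intro s n
    simp only [f]
    push_cast [Complex.ofReal_cpow (hpos n).le, Complex.ofReal_cpow (hpos' n).le]
    rfl
  let bound : ℕ → ℝ := fun n => if n = 0 then 1 / a ^ 2 + 1 / (1 - a) ^ 2 else 2 / (n : ℝ) ^ 2
  have hbound : Summable bound := by
    rw [← summable_nat_add_iff 1]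
    have := ((summable_nat_add_iff 1).mpr
      (Real.summable_one_div_nat_pow.mpr one_lt_two)).mul_left (2 : ℝ)
    refine this.congr fun n => ?_
    simp only [bound, Nat.succ_ne_zero, if_false]
    ring
  have hlim : ∀ n, Filter.Tendsto (fun s => f s n) (nhdsWithin 1 (Set.Ioi 1)) (nhds (g n)) := by
    intro n
    have hc : ContinuousAt (fun s => f s n) 1 := by
      simp_rw [hfreal]
      apply Complex.continuous_ofReal.continuousAt.comp
      have h1 := (hpos n).ne'
      have h2 := (hpos' n).ne'
      have c1 : ContinuousAt (fun s : ℝ => (n + a) ^ s) 1 :=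
        Real.continuousAt_const_rpow h1
      have c2 : ContinuousAt (fun s : ℝ => (n + 1 - a) ^ s) 1 :=
        Real.continuousAt_const_rpow h2
      exact ((continuousAt_const.div c1 (Real.rpow_pos_of_pos (hpos n) _).ne').sub
        (continuousAt_const.div c2 (Real.rpow_pos_of_pos (hpos' n) _).ne')).div_const 2
    have : f 1 n = g n := by simp [f, g]
    rw [← this]
    exact hc.tendsto.mono_left nhdsWithin_le_nhds
  have hdom : ∀ᶠ s in nhdsWithin (1 : ℝ) (Set.Ioi 1), ∀ n, ‖f s n‖ ≤ bound n := by
    filter_upwards [Ioo_mem_nhdsGT (one_lt_two : (1 : ℝ) < 2)] with s hs n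
    rw [hfreal, Complex.norm_real, Real.norm_eq_abs, abs_div, abs_two]
    rcases n.eq_zero_or_pos with rfl | hn
    · simp only [bound, if_true, Nat.cast_zero, zero_add]
      have aux : ∀ b : ℝ, 0 < b → b < 1 → 0 < 1 / b ^ s ∧ 1 / b ^ s ≤ 1 / b ^ 2 := by
        intro b h0 h1
        refine ⟨one_div_pos.mpr (Real.rpow_pos_of_pos h0 s),
          one_div_le_one_div_of_le (by positivity) ?_⟩
        rw [← Real.rpow_natCast]
        exact Real.rpow_le_rpow_of_exponent_ge h0 h1.le (by exact_mod_cast hs.2.le)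
      obtain ⟨p1, p2⟩ := aux a ha ha'
      obtain ⟨q1, q2⟩ := aux (1 - a) (by linarith) (by linarith)
      have : |1 / a ^ s - 1 / (1 - a) ^ s| ≤ 1 / a ^ 2 + 1 / (1 - a) ^ 2 := by
        rw [abs_le]
        constructor <;> linarith
      linarith [abs_nonneg (1 / a ^ s - 1 / (1 - a) ^ s)]
    · simp only [bound, hn.ne', if_false]
      have := abs_one_div_rpow_sub_le (n := n) (x := n + a) (y := n + 1 - a) (s := s)
        (by exact_mod_cast hn) (by linarith) (by linarith) (by linarith) (by linarith)
        hs.1.le hs.2.le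
      linarith [abs_nonneg (1 / (n + a) ^ s - 1 / (n + 1 - a) ^ s)]
  have h1 := tendsto_tsum_of_dominated_convergence hbound hlim hdom
  have h2 : Filter.Tendsto (fun s : ℝ => ∑' n, f s n) (nhdsWithin 1 (Set.Ioi 1))
      (nhds (HurwitzZeta.hurwitzZetaOdd a 1)) := by
    have hc : ContinuousAt (fun s : ℝ => HurwitzZeta.hurwitzZetaOdd a (s : ℂ)) 1 :=
      ((HurwitzZeta.differentiable_hurwitzZetaOdd a).continuous.comp
        Complex.continuous_ofReal).continuousAt
    have := hc.tendsto.mono_left (nhdsWithin_le_nhds (s := Set.Ioi 1))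
    rw [Complex.ofReal_one] at this
    refine this.congr' ?_
    filter_upwards [self_mem_nhdsWithin] with s hs
    exact (HurwitzZeta.hasSum_nat_hurwitzZetaOdd_of_mem_Icc ⟨ha.le, ha'.le⟩
      (by simpa using hs)).tsum_eq.symm
  rw [tendsto_nhds_unique h2 h1,
    ((hasSum_one_div_sub_one_div_eq_cot ha ha').div_const 2).tsum_eq]
  ring

/-! ### The values `L(1, χψ)` as secant sums -/

theorem mulPsi_natCast {n : ℕ} [NeZero n] (χ : DirichletCharacter ℂ n) (k : ℕ) :
    mulPsi χ (k : ZMod (4 * n)) = χ (k : ZMod n) * psiFour (k : ZMod 4) := by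
  by_cases hk : k.Coprime (4 * n)
  · rw [mulPsi, MulChar.mul_apply, ← ZMod.coe_unitOfCoprime k hk,
      DirichletCharacter.changeLevel_eq_cast_of_dvd,
      DirichletCharacter.changeLevel_eq_cast_of_dvd, ZMod.coe_unitOfCoprime, ZMod.cast_natCast,
      ZMod.cast_natCast]
    · exact Dvd.intro n rfl
    · exact Dvd.intro_left 4 rfl
  · rw [MulChar.map_nonunit _ (by rwa [ZMod.isUnit_iff_coprime])]
    rw [Nat.coprime_mul_iff_right, not_and_or] at hk
    rcases hk with hk | hk
    · rw [psiFour.map_nonunit (by rwa [ZMod.isUnit_iff_coprime]), mul_zero]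
    · rw [χ.map_nonunit (by rwa [ZMod.isUnit_iff_coprime]), zero_mul]

theorem mulPsi_odd {n : ℕ} [NeZero n] {χ : DirichletCharacter ℂ n} (hχ : χ.Even) :
    (mulPsi χ).Odd := by
  have h4 : 1 ≤ 4 * n := by have := NeZero.pos n; omega
  have hcast : ∀ d : ℕ, d ∣ 4 * n → ((4 * n - 1 : ℕ) : ZMod d) = -1 := by
    intro d hd
    rw [Nat.cast_sub h4, (ZMod.natCast_eq_zero_iff _ _).mpr hd, Nat.cast_one, zero_sub]
  rw [DirichletCharacter.Odd, ← hcast (4 * n) dvd_rfl, mulPsi_natCast, hcast n ⟨4, mul_comm _ _⟩,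
    hcast 4 ⟨n, rfl⟩, hχ, psiFour, MulChar.ringHomComp_apply,
    show ZMod.χ₄ (-1) = -1 by decide]
  simp

theorem LFunction_one_eq_sum_cot {N : ℕ} [NeZero N] {Φ : ZMod N → ℂ} (hΦ : Function.Odd Φ) :
    ZMod.LFunction Φ 1 = Real.pi / (2 * N) *
      ∑ j : ZMod N, Φ j * Complex.cot (Real.pi * j.val / N) := by
  rw [ZMod.LFunction_def_odd hΦ, Complex.cpow_neg_one, Finset.mul_sum, Finset.mul_sum]
  refine Finset.sum_congr rfl fun j _ => ?_
  have hN : (0 : ℝ) < N := by exact_mod_cast NeZero.pos N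
  by_cases hj : j = 0
  · subst hj
    have : Φ 0 = 0 := by
      have := hΦ 0
      rw [neg_zero] at this
      linear_combination this / 2
    simp [this]
  · have hj' : 0 < j.val := Nat.pos_of_ne_zero fun h => hj ((ZMod.val_eq_zero j).mp h)
    rw [ZMod.toAddCircle_apply, hurwitzZetaOdd_apply_one (by positivity)
      (by rw [div_lt_one hN]; exact_mod_cast j.val_lt)]
    push_cast
    rw [mul_div_assoc]
    have : (N : ℂ) ≠ 0 := by exact_mod_cast hN.ne'
    field_simp

/-- The Chinese remainder theorem in the form `j = n * a + 4 * c`. -/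
theorem sum_zmod_four_mul {M : Type*} [AddCommMonoid M] {n : ℕ} [NeZero n] (hn : Odd n) {F : ℕ → M}
    (hF : Function.Periodic F (4 * n)) :
    ∑ j : ZMod (4 * n), F j.val = ∑ c : ZMod n, ∑ a : ZMod 4, F (n * a.val + 4 * c.val) := by
  have hcop : Nat.Coprime 4 n := (Nat.Coprime.pow_left 2 (Nat.coprime_two_left.mpr hn) :)
  rw [← Fintype.sum_prod_type']
  symm
  let φ : ZMod n × ZMod 4 → ZMod (4 * n) := fun p => ((n * p.2.val + 4 * p.1.val : ℕ) : ZMod (4 * n))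
  have hinj : Function.Injective φ := by
    rintro ⟨c, a⟩ ⟨c', a'⟩ h
    simp only [φ] at h
    rw [ZMod.natCast_eq_natCast_iff] at h
    have h4 := (ZMod.natCast_eq_natCast_iff _ _ _).mpr (h.of_dvd ⟨n, rfl⟩ : _ ≡ _ [MOD 4])
    have hn' := (ZMod.natCast_eq_natCast_iff _ _ _).mpr (h.of_dvd ⟨4, mul_comm _ _⟩ : _ ≡ _ [MOD n])
    simp only [Nat.cast_add, Nat.cast_mul, ZMod.natCast_val, ZMod.cast_id', id, CharP.cast_eq_zero,
      zero_mul, zero_add, Nat.cast_ofNat, add_zero] at h4 hn'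
    have u1 : IsUnit (4 : ZMod n) := by
      have := (ZMod.isUnit_iff_coprime 4 n).mpr hcop
      exact_mod_cast this
    have u2 : IsUnit (n : ZMod 4) := (ZMod.isUnit_iff_coprime n 4).mpr hcop.symm
    rw [u1.mul_right_inj] at hn'
    rw [u2.mul_right_inj] at h4
    rw [hn', h4]
  have hbij : Function.Bijective φ := by
    rw [Fintype.bijective_iff_injective_and_card]
    refine ⟨hinj, ?_⟩
    rw [Fintype.card_prod, ZMod.card, ZMod.card, ZMod.card, mul_comm]
  refine Fintype.sum_bijective φ hbij _ _ fun p => ?_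
  simp only [φ]
  rw [ZMod.val_natCast, hF.map_mod_nat]

/-- At a point where `cos (2y) = 0` both sides vanish, because division by zero does. -/
theorem cot_add_sub_cot_add (y : ℂ) :
    Complex.cot (Real.pi / 4 + y) - Complex.cot (3 * Real.pi / 4 + y) = 2 / Complex.cos (2 * y) := by
  have h : (3 * Real.pi / 4 + y : ℂ) = (Real.pi / 4 + y) + Real.pi / 2 := by ring
  have h2 : Complex.cos (2 * y) = Complex.sin (2 * (Real.pi / 4 + y)) := by
    rw [← Complex.sin_add_pi_div_two]
    congr 1
    ring
  rw [h, h2, Complex.cot, Complex.cot, Complex.cos_add_pi_div_two, Complex.sin_add_pi_div_two,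
    Complex.sin_two_mul]
  set x : ℂ := Real.pi / 4 + y
  by_cases hs : Complex.sin x = 0
  · simp [hs]
  by_cases hc : Complex.cos x = 0
  · simp [hc]
  field_simp
  linear_combination Complex.sin_sq_add_cos_sq x

theorem psiFour_natCast_odd {n : ℕ} (hn : Odd n) :
    psiFour (n : ZMod 4) = (-1) ^ ((n - 1) / 2) := by
  rw [psiFour, MulChar.ringHomComp_apply,
    ZMod.χ₄_eq_neg_one_pow (Nat.odd_iff.mp hn)]
  obtain ⟨k, rfl⟩ := hn
  rw [show (2 * k + 1) / 2 = k by omega, show (2 * k + 1 - 1) / 2 = k by omega]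
  simp

/-- The sum runs over all residues modulo `n`, hence is twice the sum over `S_n`. -/
theorem mulPsi_LFunction_one {n : ℕ} [NeZero n] (hn : Odd n) {χ : DirichletCharacter ℂ n}
    (hχ : χ.Even) :
    (mulPsi χ).LFunction 1 = Real.pi / (4 * n) * (-1) ^ ((n - 1) / 2) * χ 4 *
      ∑ c : ZMod n, χ c * realSec (2 * c.val * Real.pi / n) := by
  have hn0 : (n : ℂ) ≠ 0 := by exact_mod_cast NeZero.ne n
  let F : ℕ → ℂ := fun k => χ (k : ZMod n) * psiFour (k : ZMod 4) *
    Complex.cot (Real.pi * k / (4 * n))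
  have hF : Function.Periodic F (4 * n) := by
    intro k
    have h1 : ((k + 4 * n : ℕ) : ZMod n) = k := by simp
    have h2 : ((k + 4 * n : ℕ) : ZMod 4) = k := by
      have : (4 : ZMod 4) = 0 := rfl
      simp [this]
    have h3 : (Real.pi * ((k + 4 * n : ℕ) : ℂ) / (4 * n) : ℂ) = Real.pi * k / (4 * n) + Real.pi := by
      push_cast
      field_simp
    simp only [F]
    rw [h1, h2, h3, Complex.cot, Complex.cot, Complex.cos_add_pi, Complex.sin_add_pi, neg_div_neg_eq]
  have hsum : ∑ j : ZMod (4 * n), mulPsi χ j * Complex.cot (Real.pi * j.val / (4 * n : ℕ)) =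
      ∑ j : ZMod (4 * n), F j.val := by
    refine Finset.sum_congr rfl fun j _ => ?_
    simp only [F]
    rw [← mulPsi_natCast, ZMod.natCast_zmod_val]
    push_cast
    rfl
  rw [DirichletCharacter.LFunction, LFunction_one_eq_sum_cot (mulPsi_odd hχ).to_fun, hsum,
    sum_zmod_four_mul hn hF, Finset.mul_sum, Finset.mul_sum]
  refine Finset.sum_congr rfl fun c _ => ?_
  have hχF : ∀ a : ZMod 4, F (n * a.val + 4 * c.val) = χ 4 * χ c * (psiFour n * psiFour a) *
      Complex.cot (a.val * Real.pi / 4 + Real.pi * c.val / n) := by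
    intro a
    have e4 : (4 : ZMod 4) = 0 := rfl
    have h1 : ((n * a.val + 4 * c.val : ℕ) : ZMod n) = 4 * c := by simp
    have h2 : ((n * a.val + 4 * c.val : ℕ) : ZMod 4) = n * a := by simp [e4]
    simp only [F]
    rw [h1, h2, map_mul, map_mul]
    congr 2
    push_cast
    field_simp
  have hv : ∀ a : ZMod 4, psiFour a = ((ZMod.χ₄ a : ℤ) : ℂ) := fun a => rfl
  have h4 : ∀ f : ZMod 4 → ℂ, ∑ a, f a = f 0 + f 1 + f 2 + f 3 := Fin.sum_univ_four
  have v1 : (1 : ZMod 4).val = 1 := rfl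
  have v3 : (3 : ZMod 4).val = 3 := rfl
  rw [h4, hχF, hχF, hχF, hχF, hv 0, hv 1, hv 2, hv 3, show ZMod.χ₄ 0 = 0 by decide,
    show ZMod.χ₄ 1 = 1 by decide, show ZMod.χ₄ 2 = 0 by decide, show ZMod.χ₄ 3 = -1 by decide,
    v1, v3, psiFour_natCast_odd hn]
  have hcot := cot_add_sub_cot_add (Real.pi * c.val / n)
  have hsec : ((realSec (2 * c.val * Real.pi / n) : ℝ) : ℂ) =
      1 / Complex.cos (2 * (Real.pi * c.val / n)) := by
    rw [realSec]
    push_cast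
    congr 2
    ring
  rw [hsec]
  push_cast
  rw [one_mul]
  have h8 : (Real.pi / (2 * (4 * n)) : ℂ) = Real.pi / (4 * n) * (1 / 2) := by
    field_simp
  rw [h8]
  linear_combination (Real.pi / (4 * n) * (1 / 2) * (χ 4 * χ c * (-1) ^ ((n - 1) / 2))) * hcot

/-! ### Units modulo sign -/

/-- The group `(ℤ/nℤ)ˣ / {±1}`; `halfUnits n` is a set of representatives of its elements. -/
abbrev UnitsModSign (n : ℕ) : Type := (ZMod n)ˣ ⧸ Subgroup.zpowers (-1 : (ZMod n)ˣ)

namespace UnitsModSign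

variable {n : ℕ}

theorem mk_eq_mk_iff {u v : (ZMod n)ˣ} :
    (u : UnitsModSign n) = (v : UnitsModSign n) ↔ u = v ∨ u = -v := by
  rw [QuotientGroup.eq, Subgroup.mem_zpowers_iff]
  constructor
  · rintro ⟨k, hk⟩
    rw [eq_inv_mul_iff_mul_eq] at hk
    rcases Int.even_or_odd' k with ⟨l, rfl | rfl⟩
    · left
      rw [zpow_mul] at hk
      simpa using hk
    · right
      rw [zpow_add, zpow_mul] at hk
      rw [← hk]
      simp
  · rintro (rfl | rfl)
    · exact ⟨0, by simp⟩
    · exact ⟨1, by simp⟩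

theorem card_zpowers_neg_one (hn : 2 < n) :
    Nat.card (Subgroup.zpowers (-1 : (ZMod n)ˣ)) = 2 := by
  have : Fact (2 < n) := ⟨hn⟩
  rw [Nat.card_zpowers]
  refine orderOf_eq_prime (by simp) fun h => ZMod.neg_one_ne_one (n := n) ?_
  simpa using congrArg Units.val h

theorem card_mul_two [Fintype (UnitsModSign n)] [NeZero n] (hn : 2 < n) :
    Fintype.card (UnitsModSign n) * 2 = n.totient := by
  rw [← ZMod.card_units_eq_totient n, ← Nat.card_eq_fintype_card, ← Nat.card_eq_fintype_card,
    Subgroup.card_eq_card_quotient_mul_card_subgroup (Subgroup.zpowers (-1 : (ZMod n)ˣ)),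
    card_zpowers_neg_one hn]

theorem coprime_of_mem_halfUnits {a : ℕ} (ha : a ∈ halfUnits n) : a.Coprime n :=
  (Finset.mem_filter.mp ha).2.2.2

/-- The class modulo sign of an element of `S_n`. -/
def ofHalfUnits (a : halfUnits n) : UnitsModSign n :=
  (ZMod.unitOfCoprime (a : ℕ) (coprime_of_mem_halfUnits a.2) : (ZMod n)ˣ)

theorem ofHalfUnits_bijective (hn : 2 < n) (hodd : Odd n) :
    Function.Bijective (ofHalfUnits : halfUnits n → UnitsModSign n) := by
  have : NeZero n := ⟨by omega⟩
  constructor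
  · rintro ⟨a, ha⟩ ⟨b, hb⟩ hab
    simp only [halfUnits, Finset.mem_filter, Finset.mem_range] at ha hb
    rw [ofHalfUnits, ofHalfUnits, mk_eq_mk_iff, Units.ext_iff, Units.ext_iff, Units.val_neg,
      ZMod.coe_unitOfCoprime, ZMod.coe_unitOfCoprime] at hab
    rcases hab with hab | hab
    · rw [ZMod.natCast_eq_natCast_iff'] at hab
      rw [Nat.mod_eq_of_lt ha.1, Nat.mod_eq_of_lt hb.1] at hab
      exact Subtype.ext hab
    · rw [eq_neg_iff_add_eq_zero] at hab
      have hdvd : n ∣ a + b := by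
        rw [← ZMod.natCast_eq_zero_iff]
        exact_mod_cast hab
      have := Nat.le_of_dvd (by omega) hdvd
      omega
  · intro q
    obtain ⟨u, rfl⟩ := QuotientGroup.mk_surjective q
    have hcop := ZMod.val_coe_unit_coprime u
    have hlt := (u : ZMod n).val_lt
    have hpos : 0 < (u : ZMod n).val := by
      rcases Nat.eq_zero_or_pos (u : ZMod n).val with h | h
      · rw [h, Nat.coprime_zero_left] at hcop
        omega
      · exact h
    rcases lt_or_ge (2 * (u : ZMod n).val) n with h | h
    · refine ⟨⟨(u : ZMod n).val, ?_⟩, ?_⟩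
      · simp only [halfUnits, Finset.mem_filter, Finset.mem_range]
        exact ⟨hlt, hpos, h, hcop⟩
      · rw [ofHalfUnits, mk_eq_mk_iff]
        left
        ext
        simp
    · refine ⟨⟨n - (u : ZMod n).val, ?_⟩, ?_⟩
      · simp only [halfUnits, Finset.mem_filter, Finset.mem_range]
        refine ⟨by omega, by omega, ?_, (Nat.coprime_self_sub_left hlt.le).mpr hcop⟩
        obtain ⟨k, rfl⟩ := hodd
        omega
      · rw [ofHalfUnits, mk_eq_mk_iff]
        right
        ext
        simp [Nat.cast_sub hlt.le]

/-- The function on `(ℤ/nℤ)ˣ / {±1}` sending the class of `a` to `sec (2aπ/n)`. The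
chosen representative does not matter, by `UnitsModSign.secant_mk`. -/
noncomputable def secant (g : UnitsModSign n) : ℝ :=
  realSec (2 * ((g.out : (ZMod n)ˣ) : ZMod n).val * Real.pi / n)

theorem realSec_eq_of_natCast_eq_or_eq_neg [NeZero n] {a b : ℕ}
    (h : (a : ZMod n) = b ∨ (a : ZMod n) = -b) :
    realSec (2 * a * Real.pi / n) = realSec (2 * b * Real.pi / n) := by
  have hn : (n : ℝ) ≠ 0 := by exact_mod_cast NeZero.ne n
  rw [realSec, realSec]
  congr 1
  rcases h with h | h
  · have h' : ((a : ℤ) : ZMod n) = ((b : ℤ) : ZMod n) := by exact_mod_cast h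
    rw [← sub_eq_zero, ← Int.cast_sub, ZMod.intCast_zmod_eq_zero_iff_dvd] at h'
    obtain ⟨k, hk⟩ := h'
    have hk' : (a : ℝ) = b + n * k := by
      have : (a : ℝ) - b = n * k := by exact_mod_cast hk
      linarith
    rw [← Real.cos_add_int_mul_two_pi (2 * b * Real.pi / n) k, hk']
    congr 1
    field_simp
  · rw [eq_neg_iff_add_eq_zero] at h
    have h' : ((a + b : ℤ) : ZMod n) = 0 := by exact_mod_cast h
    rw [ZMod.intCast_zmod_eq_zero_iff_dvd] at h'
    obtain ⟨k, hk⟩ := h'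
    have hk' : (a : ℝ) = -b + n * k := by
      have : (a : ℝ) + b = n * k := by exact_mod_cast hk
      linarith
    rw [← Real.cos_neg (2 * b * Real.pi / n),
      ← Real.cos_add_int_mul_two_pi (-(2 * b * Real.pi / n)) k, hk']
    congr 1
    field_simp

theorem secant_mk [NeZero n] (u : (ZMod n)ˣ) {a : ℕ} (ha : (a : ZMod n) = u) :
    secant (u : UnitsModSign n) = realSec (2 * a * Real.pi / n) := by
  rw [secant]
  apply realSec_eq_of_natCast_eq_or_eq_neg
  rw [ZMod.natCast_zmod_val, ha]
  have := mk_eq_mk_iff.mp (QuotientGroup.out_eq' (u : UnitsModSign n))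
  simpa [Units.ext_iff] using this

/-- An even Dirichlet character, as a character of `(ℤ/nℤ)ˣ / {±1}`. -/
noncomputable def liftEven (χ : DirichletCharacter ℂ n) (hχ : χ.Even) : UnitsModSign n →* ℂ :=
  QuotientGroup.lift _ (χ.toMonoidHom.comp (Units.coeHom (ZMod n))) <| by
    rw [Subgroup.zpowers_le, MonoidHom.mem_ker]
    exact hχ

theorem liftEven_mk (χ : DirichletCharacter ℂ n) (hχ : χ.Even) (u : (ZMod n)ˣ) :
    liftEven χ hχ u = χ u := rfl

theorem liftEven_injective {χ χ' : DirichletCharacter ℂ n} (hχ : χ.Even) (hχ' : χ'.Even)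
    (h : liftEven χ hχ = liftEven χ' hχ') : χ = χ' :=
  MulChar.ext fun u => DFunLike.congr_fun h (u : UnitsModSign n)

end UnitsModSign

theorem mem_evenCharacters {n : ℕ} [NeZero n] {χ : DirichletCharacter ℂ n} :
    χ ∈ evenCharacters n ↔ χ.Even := by
  simp [evenCharacters]

/-- Half of the Dirichlet characters are even, because `∑ χ (-1) = 0`. -/
theorem card_evenCharacters_mul_two {n : ℕ} [NeZero n] (hn : 2 < n) :
    (evenCharacters n).card * 2 = n.totient := by
  classical
  have : Fact (2 < n) := ⟨hn⟩
  have h0 := DirichletCharacter.sum_characters_eq_zero ℂ (ZMod.neg_one_ne_one (n := n))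
  have h1 : ∀ χ : DirichletCharacter ℂ n,
      χ (-1) = (if χ ∈ evenCharacters n then 2 else 0) - 1 := by
    intro χ
    split_ifs with h <;> rw [mem_evenCharacters] at h
    · rw [h]
      norm_num
    · rw [χ.even_or_odd.resolve_left h]
      norm_num
  rw [Finset.sum_congr rfl fun χ _ => h1 χ, Finset.sum_sub_distrib, Finset.sum_ite_mem,
    Finset.univ_inter, Finset.sum_const, Finset.sum_const, nsmul_eq_mul, nsmul_eq_mul, mul_one,
    Finset.card_univ, ← Nat.card_eq_fintype_card,
    DirichletCharacter.card_eq_totient_of_hasEnoughRootsOfUnity] at h0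
  exact_mod_cast sub_eq_zero.mp h0

/-- The set of even characters is stable under inversion. -/
theorem prod_evenCharacters_mul_self_eq_one {n : ℕ} [NeZero n] {a : ZMod n} (ha : IsUnit a) :
    (∏ χ ∈ evenCharacters n, χ a) * ∏ χ ∈ evenCharacters n, χ a = 1 := by
  have h : ∏ χ ∈ evenCharacters n, χ a = ∏ χ ∈ evenCharacters n, χ⁻¹ a := by
    have hmem : ∀ χ ∈ evenCharacters n, χ⁻¹ ∈ evenCharacters n := by
      intro χ hχ
      rw [mem_evenCharacters] at hχ ⊢
      rw [DirichletCharacter.Even, MulChar.inv_apply_eq_inv', hχ, inv_one]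
    exact Finset.prod_bij' (fun χ _ => χ⁻¹) (fun χ _ => χ⁻¹) hmem hmem
      (fun χ _ => inv_inv χ) (fun χ _ => inv_inv χ) (fun χ _ => by rw [inv_inv])
  nth_rw 2 [h]
  rw [← Finset.prod_mul_distrib]
  refine Finset.prod_eq_one fun χ _ => ?_
  rw [← MulChar.mul_apply, mul_inv_cancel, MulChar.one_apply ha]

theorem sum_mul_realSec_eq {n : ℕ} [NeZero n] [Fintype (UnitsModSign n)] (hn : 2 < n)
    (χ : DirichletCharacter ℂ n) (hχ : χ.Even) :
    ∑ c : ZMod n, χ c * realSec (2 * c.val * Real.pi / n) =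
      2 * ∑ g, UnitsModSign.liftEven χ hχ g * (UnitsModSign.secant g : ℂ) := by
  classical
  have h := QuotientGroup.sum_mk_eq_nsmul (Subgroup.zpowers (-1 : (ZMod n)ˣ))
    fun g => UnitsModSign.liftEven χ hχ g * (UnitsModSign.secant g : ℂ)
  rw [UnitsModSign.card_zpowers_neg_one hn, nsmul_eq_mul, Nat.cast_ofNat] at h
  rw [← h]
  symm
  refine Finset.sum_of_injOn Units.val (fun u _ v _ huv => Units.ext huv)
    (fun u _ => Finset.mem_coe.mpr (Finset.mem_univ _)) (fun c _ hc => ?_) fun u _ => ?_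
  · rw [χ.map_nonunit, zero_mul]
    rintro ⟨u, rfl⟩
    exact hc ⟨u, by simp, rfl⟩
  · rw [UnitsModSign.liftEven_mk, UnitsModSign.secant_mk u (ZMod.natCast_zmod_val _)]

theorem secMatrix_det_eq {n : ℕ} [NeZero n] [Fintype (UnitsModSign n)]
    [DecidableEq (UnitsModSign n)] (hn : 2 < n) (hodd : Odd n) :
    (((secMatrix n).det : ℝ) : ℂ) =
      ((Equiv.Perm.sign (Equiv.inv (UnitsModSign n)) : ℤ) : ℂ) *
        ∏ χ : {χ // χ ∈ evenCharacters n}, ∑ g,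
          UnitsModSign.liftEven χ.1 (mem_evenCharacters.mp χ.2) g * (UnitsModSign.secant g : ℂ) := by
  have hcard : Fintype.card {χ // χ ∈ evenCharacters n} = Fintype.card (UnitsModSign n) := by
    have h1 := card_evenCharacters_mul_two hn
    have h2 := UnitsModSign.card_mul_two hn
    rw [Fintype.card_coe]
    omega
  rw [← Matrix.det_mul_table_eq_sign_mul_prod (fun g => (UnitsModSign.secant g : ℂ))
    (fun χ : {χ // χ ∈ evenCharacters n} =>
      UnitsModSign.liftEven χ.1 (mem_evenCharacters.mp χ.2))
    (fun χ χ' h => Subtype.ext (UnitsModSign.liftEven_injective _ _ h)) hcard,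
    ← Matrix.det_submatrix_equiv_self
      (Equiv.ofBijective _ (UnitsModSign.ofHalfUnits_bijective hn hodd)),
    ← Complex.ofRealHom_eq_coe, RingHom.map_det]
  congr 1
  ext j k
  have : UnitsModSign.ofHalfUnits j * UnitsModSign.ofHalfUnits k =
      ((ZMod.unitOfCoprime (j : ℕ) (UnitsModSign.coprime_of_mem_halfUnits j.2) *
        ZMod.unitOfCoprime (k : ℕ) (UnitsModSign.coprime_of_mem_halfUnits k.2) : (ZMod n)ˣ) :
        UnitsModSign n) := rfl
  simp only [RingHom.mapMatrix_apply, Matrix.map_apply, Matrix.submatrix_apply, Matrix.of_apply,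
    Equiv.ofBijective_apply, secMatrix, Complex.ofRealHom_eq_coe]
  rw [this, UnitsModSign.secant_mk _ (a := j * k) (by simp)]
  push_cast
  rw [← mul_assoc]

/-! ### Counting square roots of `1` and `-1` modulo `n` -/

/-- The number of square roots of the integer `s` modulo `n`. -/
noncomputable def ZMod.numSqrt (s : ℤ) (n : ℕ) : ℕ := Nat.card {x : ZMod n // x ^ 2 = s}

theorem ZMod.numSqrt_mul (s : ℤ) {a b : ℕ} (hab : a.Coprime b) :
    ZMod.numSqrt s (a * b) = ZMod.numSqrt s a * ZMod.numSqrt s b := by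
  rw [numSqrt, numSqrt, numSqrt, ← Nat.card_prod]
  let e := ZMod.chineseRemainder hab
  refine Nat.card_congr ((e.toEquiv.subtypeEquiv (q := fun p => p.1 ^ 2 = (s : ZMod a) ∧
    p.2 ^ 2 = (s : ZMod b)) fun x => ?_).trans (Equiv.subtypeProdEquivProd
      (p := fun y : ZMod a => y ^ 2 = s) (q := fun z : ZMod b => z ^ 2 = s)))
  change x ^ 2 = s ↔ (e x).1 ^ 2 = s ∧ (e x).2 ^ 2 = s
  rw [← e.injective.eq_iff, map_pow, map_intCast, Prod.ext_iff]
  rfl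

theorem ZMod.sq_eq_one_iff_of_odd_prime_pow {p e : ℕ} (hp : p.Prime) (hp2 : p ≠ 2)
    (x : ZMod (p ^ e)) : x ^ 2 = 1 ↔ x = 1 ∨ x = -1 := by
  refine ⟨fun h => ?_, by rintro (rfl | rfl) <;> ring⟩
  obtain ⟨z, rfl⟩ := ZMod.intCast_surjective x
  have hdvd : ((p : ℤ) ^ e) ∣ (z - 1) * (z + 1) := by
    have : (((z - 1) * (z + 1) : ℤ) : ZMod (p ^ e)) = 0 := by
      push_cast
      linear_combination h
    exact_mod_cast (ZMod.intCast_zmod_eq_zero_iff_dvd _ _).mp this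
  have hpi : Prime (p : ℤ) := Nat.prime_iff_prime_int.mp hp
  have hnot : ¬((p : ℤ) ∣ z - 1 ∧ (p : ℤ) ∣ z + 1) := by
    rintro ⟨h1, h2⟩
    have h3 : (p : ℤ) ∣ (2 : ℕ) := by
      have := dvd_sub h2 h1
      rwa [show z + 1 - (z - 1) = (2 : ℕ) by push_cast; ring] at this
    exact hp2 ((Nat.prime_dvd_prime_iff_eq hp Nat.prime_two).mp (Int.natCast_dvd_natCast.mp h3))
  by_cases h1 : (p : ℤ) ∣ z - 1
  · left
    have hc : IsCoprime ((p : ℤ) ^ e) (z + 1) :=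
      ((Prime.coprime_iff_not_dvd hpi).mpr fun h2 => hnot ⟨h1, h2⟩).pow_left
    have h4 := hc.dvd_of_dvd_mul_right hdvd
    have : ((z - 1 : ℤ) : ZMod (p ^ e)) = 0 := by
      rw [ZMod.intCast_zmod_eq_zero_iff_dvd]
      exact_mod_cast h4
    push_cast at this
    exact sub_eq_zero.mp this
  · right
    have hc : IsCoprime ((p : ℤ) ^ e) (z - 1) :=
      ((Prime.coprime_iff_not_dvd hpi).mpr h1).pow_left
    have h4 := hc.dvd_of_dvd_mul_left hdvd
    have : ((z + 1 : ℤ) : ZMod (p ^ e)) = 0 := by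
      rw [ZMod.intCast_zmod_eq_zero_iff_dvd]
      exact_mod_cast h4
    push_cast at this
    exact eq_neg_of_add_eq_zero_left this

theorem Nat.two_lt_odd_prime_pow {p e : ℕ} (hp : p.Prime) (hp2 : p ≠ 2) (he : e ≠ 0) :
    2 < p ^ e :=
  (lt_of_le_of_ne hp.two_le hp2.symm).trans_le (Nat.le_self_pow he p)

theorem ZMod.numSqrt_one_odd_prime_pow {p e : ℕ} (hp : p.Prime) (hp2 : p ≠ 2) (he : e ≠ 0) :
    ZMod.numSqrt 1 (p ^ e) = 2 := by
  have : Fact (2 < p ^ e) := ⟨Nat.two_lt_odd_prime_pow hp hp2 he⟩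
  refine Eq.trans ?_ (Set.ncard_pair (ZMod.neg_one_ne_one (n := p ^ e)).symm)
  rw [← Nat.card_coe_set_eq]
  refine Nat.card_congr (Equiv.subtypeEquivRight fun x => ?_)
  rw [Int.cast_one, ZMod.sq_eq_one_iff_of_odd_prime_pow hp hp2]
  rfl

/-- For `p ≡ 1 [MOD 4]`, a square root of `-1` is an element of order `4` in the cyclic group of
units, and the other square roots of `-1` differ from it by square roots of `1`. -/
theorem ZMod.numSqrt_neg_one_odd_prime_pow {p e : ℕ} (hp : p.Prime) (hp2 : p ≠ 2) (he : e ≠ 0) :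
    ZMod.numSqrt (-1) (p ^ e) = if p % 4 = 1 then 2 else 0 := by
  have : Fact (2 < p ^ e) := ⟨Nat.two_lt_odd_prime_pow hp hp2 he⟩
  have : NeZero (p ^ e) := ⟨(pow_pos hp.pos e).ne'⟩
  have : Fact p.Prime := ⟨hp⟩
  split_ifs with h
  · obtain ⟨g, hg⟩ := (ZMod.isCyclic_units_of_prime_pow p hp hp2 e).exists_generator
    have hord : orderOf g = p ^ (e - 1) * (p - 1) := by
      rw [orderOf_eq_card_of_forall_mem_zpowers hg, Nat.card_eq_fintype_card,
        ZMod.card_units_eq_totient, Nat.totient_prime_pow hp (Nat.pos_of_ne_zero he)]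
    have h4 : 4 ∣ orderOf g := by
      rw [hord]
      exact Dvd.dvd.mul_left (by omega) _
    obtain ⟨k, hk⟩ := h4
    have hk0 : 0 < k := by
      have := orderOf_pos g
      omega
    have hsq : (((g ^ k : (ZMod (p ^ e))ˣ) : ZMod (p ^ e))) ^ 2 = -1 := by
      have h1 : ((((g ^ k : (ZMod (p ^ e))ˣ) : ZMod (p ^ e))) ^ 2) ^ 2 = 1 := by
        rw [← pow_mul, ← Units.val_pow_eq_pow_val, ← pow_mul,
          show k * (2 * 2) = orderOf g by rw [hk]; ring, pow_orderOf_eq_one, Units.val_one]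
      refine ((ZMod.sq_eq_one_iff_of_odd_prime_pow hp hp2 _).mp h1).resolve_left fun h2 => ?_
      rw [← Units.val_pow_eq_pow_val, ← pow_mul, Units.val_eq_one] at h2
      have := Nat.le_of_dvd (by omega) (orderOf_dvd_of_pow_eq_one h2)
      omega
    rw [← ZMod.numSqrt_one_odd_prime_pow hp hp2 he, numSqrt, numSqrt]
    refine Nat.card_congr (((Units.mulLeft (g ^ k)).subtypeEquiv fun x => ?_).symm)
    rw [Units.mulLeft_apply, mul_pow, hsq]
    push_cast
    rw [neg_one_mul, neg_inj]
  · rw [numSqrt, Nat.card_eq_zero]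
    left
    constructor
    rintro ⟨x, hx⟩
    have h3 : p % 4 ≠ 3 := by
      refine (ZMod.exists_sq_eq_neg_one_iff (p := p)).mp ⟨ZMod.castHom (dvd_pow_self p he) _ x, ?_⟩
      rw [← sq, ← map_pow, hx, map_intCast]
      simp
    have := hp.eq_two_or_odd
    omega

theorem ZMod.numSqrt_eq_prod (s : ℤ) {n : ℕ} (hn : n ≠ 0) :
    ZMod.numSqrt s n = ∏ p ∈ n.primeFactors, ZMod.numSqrt s (p ^ n.factorization p) := by
  rw [Nat.multiplicative_factorization (ZMod.numSqrt s) (fun a b => ZMod.numSqrt_mul s) ?_ hn]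
  · rfl
  · rw [numSqrt, Nat.card_eq_one_iff_unique]
    exact ⟨inferInstance, ⟨⟨0, Subsingleton.elim _ _⟩⟩⟩

theorem ZMod.numSqrt_one {n : ℕ} (hodd : Odd n) :
    ZMod.numSqrt 1 n = 2 ^ n.primeFactors.card := by
  have hn : n ≠ 0 := hodd.pos.ne'
  rw [ZMod.numSqrt_eq_prod 1 hn, ← Finset.prod_const]
  refine Finset.prod_congr rfl fun p hp => ?_
  have hpp := Nat.prime_of_mem_primeFactors hp
  have hpd := Nat.dvd_of_mem_primeFactors hp
  refine ZMod.numSqrt_one_odd_prime_pow hpp (fun h => ?_)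
    (hpp.factorization_pos_of_dvd hn hpd).ne'
  subst h
  exact Nat.not_even_iff_odd.mpr hodd (even_iff_two_dvd.mpr hpd)

theorem ZMod.numSqrt_neg_one {n : ℕ} (hodd : Odd n) :
    ZMod.numSqrt (-1) n =
      if ∀ p ∈ n.primeFactors, p % 4 = 1 then 2 ^ n.primeFactors.card else 0 := by
  have hn : n ≠ 0 := hodd.pos.ne'
  have hlocal : ∀ p ∈ n.primeFactors, ZMod.numSqrt (-1) (p ^ n.factorization p) =
      if p % 4 = 1 then 2 else 0 := by
    intro p hp
    have hpp := Nat.prime_of_mem_primeFactors hp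
    have hpd := Nat.dvd_of_mem_primeFactors hp
    refine ZMod.numSqrt_neg_one_odd_prime_pow hpp (fun h => ?_)
      (hpp.factorization_pos_of_dvd hn hpd).ne'
    subst h
    exact Nat.not_even_iff_odd.mpr hodd (even_iff_two_dvd.mpr hpd)
  rw [ZMod.numSqrt_eq_prod (-1) hn, Finset.prod_congr rfl hlocal, Finset.prod_ite_zero,
    Finset.prod_const]

/-- An element of `(ℤ/nℤ)ˣ / {±1}` of order at most `2` comes from two units with square `±1`. -/
theorem UnitsModSign.card_sq_eq_one_mul_two {n : ℕ} [NeZero n] [Fintype (UnitsModSign n)]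
    [DecidableEq (UnitsModSign n)] (hn : 2 < n) :
    Fintype.card {g : UnitsModSign n // g ^ 2 = 1} * 2 =
      ZMod.numSqrt 1 n + ZMod.numSqrt (-1) n := by
  classical
  have : Fact (2 < n) := ⟨hn⟩
  have hunits : ∀ s : ℤ, s * s = 1 →
      ZMod.numSqrt s n = ∑ u : (ZMod n)ˣ, if (u : ZMod n) ^ 2 = s then 1 else 0 := by
    intro s hs
    rw [← Finset.card_filter, ← Fintype.card_subtype, ← Nat.card_eq_fintype_card, ZMod.numSqrt]
    symm
    refine Nat.card_congr (Equiv.ofBijective (fun u => ⟨(u.1 : ZMod n), u.2⟩) ⟨?_, ?_⟩)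
    · intro u v huv
      exact Subtype.ext (Units.ext (congrArg Subtype.val huv))
    · rintro ⟨x, hx⟩
      have hxs : x * (x * s) = 1 := by
        rw [← mul_assoc, ← sq, hx]
        exact_mod_cast congrArg (Int.cast : ℤ → ZMod n) hs
      exact ⟨⟨Units.mkOfMulEqOne x _ hxs, hx⟩, rfl⟩
  have hsum := QuotientGroup.sum_mk_eq_nsmul (Subgroup.zpowers (-1 : (ZMod n)ˣ))
    fun g => if g ^ 2 = 1 then (1 : ℕ) else 0
  have hcard : Fintype.card {g : UnitsModSign n // g ^ 2 = 1} =
      ∑ g : UnitsModSign n, if g ^ 2 = 1 then 1 else 0 := by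
    rw [Fintype.card_subtype, Finset.card_filter]
  rw [card_zpowers_neg_one hn, ← hcard, smul_eq_mul] at hsum
  rw [mul_comm, ← hsum, hunits 1 rfl, hunits (-1) rfl, ← Finset.sum_add_distrib]
  refine Finset.sum_congr rfl fun u _ => ?_
  have h1 : ((u : UnitsModSign n) ^ 2 = 1) ↔ (u : ZMod n) ^ 2 = 1 ∨ (u : ZMod n) ^ 2 = -1 := by
    rw [← QuotientGroup.mk_pow, ← QuotientGroup.mk_one, mk_eq_mk_iff]
    simp [Units.ext_iff]
  simp only [h1, Int.cast_one, Int.cast_neg]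
  by_cases ha : (u : ZMod n) ^ 2 = 1
  · rw [ha, if_pos (Or.inl rfl), if_pos rfl, if_neg (ZMod.neg_one_ne_one).symm]
  · simp [ha]

/-! ### The sign of inversion -/

theorem Nat.two_pow_card_primeFactors_dvd_totient {n : ℕ} (hodd : Odd n) :
    2 ^ n.primeFactors.card ∣ n.totient := by
  rw [Nat.totient_eq_prod_factorization hodd.pos.ne', ← Finset.prod_const]
  refine Finset.prod_dvd_prod_of_dvd _ _ fun p hp => Dvd.dvd.mul_left ?_ _
  have h1 := (Nat.odd_iff.mp (hodd.of_dvd_nat (Nat.dvd_of_mem_primeFactors hp)))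
  omega

/-- The parity of `(C - t) / 2`, for the numbers `C` and `t` of all elements and of elements of order at
most `2` of `(ℤ/nℤ)ˣ / {±1}`, when `n = p ^ e`. -/
theorem odd_half_sub_iff_of_prime_pow {p e C t : ℕ} (hp : Odd p) (he : 1 ≤ e) (htC : t ≤ C)
    (hC : C * 2 = p ^ (e - 1) * (p - 1)) (ht : t * 2 = 2 + if p % 4 = 1 then 2 else 0) :
    Odd ((C - t) / 2) ↔ p % 8 = 1 ∨ p % 8 = (4 * e + 3) % 8 := by
  obtain ⟨j, hj⟩ : Odd (p ^ (e - 1)) := hp.pow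
  have hp2 := Nat.odd_iff.mp hp
  rw [Nat.odd_iff]
  split_ifs at ht with h4
  · obtain ⟨k, rfl⟩ : ∃ k, p = 4 * k + 1 := ⟨p / 4, by omega⟩
    rw [Nat.add_sub_cancel] at hC
    rw [hj] at hC
    obtain ⟨l, rfl | rfl⟩ := Nat.even_or_odd' k
    · have : C = 4 * ((2 * j + 1) * l) := by linarith
      omega
    · have : C = 8 * (j * l) + 4 * j + 4 * l + 2 := by linarith
      omega
  · have hC' : C = p ^ (e - 1) * ((p - 1) / 2) := by
      have : p - 1 = 2 * ((p - 1) / 2) := by omega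
      rw [this] at hC
      linarith
    have hmod : C % 4 = (p ^ (e - 1) % 4) * ((p - 1) / 2 % 4) % 4 := by rw [hC', Nat.mul_mod]
    have h3 : p % 4 = 3 := by omega
    have hpow : p ^ (e - 1) % 4 = if e % 2 = 1 then 1 else 3 := by
      rw [Nat.pow_mod, h3]
      split_ifs with h
      · obtain ⟨i, hi⟩ : ∃ i, e - 1 = 2 * i := ⟨(e - 1) / 2, by omega⟩
        rw [hi, pow_mul, Nat.pow_mod]
        norm_num
      · obtain ⟨i, hi⟩ : ∃ i, e - 1 = 2 * i + 1 := ⟨(e - 1) / 2, by omega⟩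
        rw [hi, pow_add, pow_mul, Nat.mul_mod, Nat.pow_mod]
        norm_num
    rw [hpow] at hmod
    have h8 : (p - 1) / 2 % 4 = 1 ∧ p % 8 = 3 ∨ (p - 1) / 2 % 4 = 3 ∧ p % 8 = 7 := by omega
    rcases h8 with ⟨h8, h8'⟩ | ⟨h8, h8'⟩ <;> rw [h8] at hmod <;> split_ifs at hmod <;> omega

/-- The parity of `(C - t) / 2`, for the numbers `C` and `t` of all elements and of elements of order at
most `2` of `(ℤ/nℤ)ˣ / {±1}`, when `n = p ^ e * q ^ f`; here `a` and `b` stand for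
`p ^ (e - 1)` and `q ^ (f - 1)`. -/
theorem odd_half_sub_iff_of_two_primes {p q a b C t : ℕ} (hp : Odd p) (hq : Odd q) (ha : Odd a)
    (hb : Odd b) (htC : t ≤ C) (hC : C * 2 = (a * (p - 1)) * (b * (q - 1)))
    (ht : t * 2 = 4 + if p % 4 = 1 ∧ q % 4 = 1 then 4 else 0) :
    Odd ((C - t) / 2) ↔ (p + q) % 4 = 0 := by
  rw [Nat.odd_iff]
  obtain ⟨j, hj⟩ : Odd (a * b) := ha.mul hb
  have hC1 : C * 2 = (2 * j + 1) * ((p - 1) * (q - 1)) := by rw [hC, ← hj]; ring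
  obtain ⟨k, hk⟩ := hp
  obtain ⟨l, hl⟩ := hq
  rw [hk, hl, Nat.add_sub_cancel, Nat.add_sub_cancel] at hC1
  have hC2 : C = 2 * ((2 * j + 1) * (k * l)) := by linarith
  obtain ⟨k', rfl | rfl⟩ := Nat.even_or_odd' k <;> obtain ⟨l', rfl | rfl⟩ := Nat.even_or_odd' l
  · have : C = 8 * ((2 * j + 1) * (k' * l')) := by rw [hC2]; ring
    rw [if_pos (by omega)] at ht
    omega
  · have : C = 4 * ((2 * j + 1) * (k' * (2 * l' + 1))) := by rw [hC2]; ring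
    rw [if_neg (by omega)] at ht
    omega
  · have : C = 4 * ((2 * j + 1) * ((2 * k' + 1) * l')) := by rw [hC2]; ring
    rw [if_neg (by omega)] at ht
    omega
  · have : C = 4 * (j * (4 * (k' * l') + 2 * k' + 2 * l' + 1) + (2 * (k' * l') + k' + l')) + 2 := by
      rw [hC2]; ring
    rw [if_neg (by omega)] at ht
    omega

theorem secSign_eq_sign {n : ℕ} [NeZero n] [Fintype (UnitsModSign n)]
    [DecidableEq (UnitsModSign n)] (hn : 2 < n) (hodd : Odd n) :
    secSign n = (Equiv.Perm.sign (Equiv.inv (UnitsModSign n)) : ℤ) := by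
  classical
  rw [Equiv.Perm.sign_inv_group]
  have hC := UnitsModSign.card_mul_two hn
  have ht := UnitsModSign.card_sq_eq_one_mul_two hn
  have htC := Fintype.card_subtype_le fun g : UnitsModSign n => g ^ 2 = 1
  rw [ZMod.numSqrt_one hodd, ZMod.numSqrt_neg_one hodd] at ht
  generalize Fintype.card (UnitsModSign n) = C at hC htC ⊢
  generalize Fintype.card {g : UnitsModSign n // g ^ 2 = 1} = t at ht htC ⊢
  have hoddp : ∀ p ∈ n.primeFactors, Odd p :=
    fun p hp => hodd.of_dvd_nat (Nat.dvd_of_mem_primeFactors hp)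
  have hpos : n.primeFactors.card ≠ 0 := by
    rw [Ne, Finset.card_eq_zero, Nat.primeFactors_eq_empty]
    omega
  have hsign : ∀ (P : Prop) [Decidable P], (Odd ((C - t) / 2) ↔ P) →
      (((-1) ^ ((C - t) / 2) : ℤˣ) : ℤ) = if P then -1 else 1 := by
    intro P _ hP
    rw [Units.val_pow_eq_pow_val, Units.val_neg, Units.val_one]
    split_ifs with h
    · exact (hP.mpr h).neg_one_pow
    · exact (Nat.not_odd_iff_even.mp fun h' => h (hP.mp h')).neg_one_pow
  have hone : ∀ p e : ℕ, p.Prime → 1 ≤ e → n = p ^ e → n.primeFactors.card = 1 := by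
    rintro p e hp he rfl
    rw [Nat.primeFactors_prime_pow (by omega) hp, Finset.card_singleton]
  have htwo : ∀ p q : ℕ, p ≠ q → n.primeFactors = {p, q} → n.primeFactors.card = 2 := by
    intro p q hpq h
    rw [h, Finset.card_pair hpq]
  obtain hr | hr | hr : n.primeFactors.card = 1 ∨ n.primeFactors.card = 2 ∨
      3 ≤ n.primeFactors.card := by omega
  · obtain ⟨p, hpf⟩ := Finset.card_eq_one.mp hr
    have hmem : p ∈ n.primeFactors := by rw [hpf]; exact Finset.mem_singleton_self p
    have hp := Nat.prime_of_mem_primeFactors hmem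
    obtain ⟨e, he, rfl⟩ : ∃ e, 1 ≤ e ∧ n = p ^ e := by
      refine ⟨n.factorization p,
        hp.factorization_pos_of_dvd (by omega) (Nat.dvd_of_mem_primeFactors hmem), ?_⟩
      conv_lhs => rw [← Nat.prod_factorization_pow_eq_self (n := n) (by omega), Finsupp.prod,
        Nat.support_factorization, hpf, Finset.prod_singleton]
    rw [Nat.totient_prime_pow hp he] at hC
    rw [hr] at ht
    simp only [hpf, Finset.mem_singleton, forall_eq, pow_one] at ht
    rw [hsign _ (odd_half_sub_iff_of_prime_pow (hoddp p hmem) he htC hC ht), secSign]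
    have hiff : (∃ p' e' : ℕ, p'.Prime ∧ 1 ≤ e' ∧ p ^ e = p' ^ e' ∧
        (p' ≡ 1 [MOD 8] ∨ p' ≡ 4 * e' + 3 [MOD 8])) ↔ p % 8 = 1 ∨ p % 8 = (4 * e + 3) % 8 := by
      constructor
      · rintro ⟨p', e', hp', he', heq, h⟩
        obtain ⟨rfl, rfl⟩ : p = p' ∧ e = e' := by
          have hpp : p = p' := (Nat.prime_dvd_prime_iff_eq hp hp').mp
            (hp.dvd_of_dvd_pow (heq ▸ dvd_pow_self p (by omega)))
          subst hpp
          exact ⟨rfl, Nat.pow_right_injective hp.two_le heq⟩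
        exact h
      · exact fun h => ⟨p, e, hp, he, rfl, h⟩
    rw [if_congr hiff rfl rfl]
    congr 1
    rw [if_neg]
    rintro ⟨p', q', hpq, h, -⟩
    have := htwo p' q' hpq h
    omega
  · obtain ⟨p, q, hpq, hpf⟩ := Finset.card_eq_two.mp hr
    have hmemp : p ∈ n.primeFactors := by simp [hpf]
    have hmemq : q ∈ n.primeFactors := by simp [hpf]
    rw [Nat.totient_eq_prod_factorization (by omega), Finsupp.prod, Nat.support_factorization, hpf,
      Finset.prod_pair hpq] at hC
    rw [hr] at ht
    simp only [hpf, Finset.mem_insert, Finset.mem_singleton, forall_eq_or_imp, forall_eq] at ht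
    rw [hsign _ (odd_half_sub_iff_of_two_primes (hoddp p hmemp) (hoddp q hmemq)
      (hoddp p hmemp).pow (hoddp q hmemq).pow htC hC ht), secSign, if_neg]
    · refine if_congr ⟨?_, fun h => ⟨p, q, hpq, hpf, h⟩⟩ rfl rfl
      rintro ⟨p', q', hpq', hpf', h⟩
      have hsum : p + q = p' + q' := by
        have h1 : ∑ x ∈ ({p, q} : Finset ℕ), x = ∑ x ∈ ({p', q'} : Finset ℕ), x := by
          rw [← hpf, ← hpf']
        rwa [Finset.sum_pair hpq, Finset.sum_pair hpq'] at h1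
      rw [hsum]
      exact h
    · rintro ⟨p', e', hp', he', heq, -⟩
      have := hone p' e' hp' he' heq
      omega
  · obtain ⟨i, hi⟩ : ∃ i, n.primeFactors.card = i + 3 := ⟨n.primeFactors.card - 3, by omega⟩
    obtain ⟨c, hc⟩ := Nat.two_pow_card_primeFactors_dvd_totient hodd
    rw [hi, pow_add] at ht hc
    obtain ⟨b, hb⟩ : ∃ b, C = 4 * b := ⟨2 ^ i * c, by linarith⟩
    have ht4 : ∃ d, t = 4 * d := by
      split_ifs at ht
      · exact ⟨2 * 2 ^ i, by omega⟩
      · exact ⟨2 ^ i, by omega⟩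
    obtain ⟨d, hd⟩ := ht4
    rw [hsign False (iff_of_false (by rw [Nat.odd_iff]; omega) not_false), if_neg not_false,
      secSign, if_neg, if_neg]
    · rintro ⟨p', q', hpq, h, -⟩
      have := htwo p' q' hpq h
      omega
    · rintro ⟨p', e', hp', he', heq, -⟩
      have := hone p' e' hp' he' heq
      omega

/-! ### The determinant -/

theorem theorem1p1 (n m : ℕ) [NeZero n] (hn : 3 ≤ n) (hodd : Odd n)
    (hm : m = Nat.totient n / 2) :
    (((secMatrix n).det : ℝ) : ℂ) =
      (secSign n : ℂ) * (-1 : ℂ) ^ ((n - 1) * m / 2) * (2 * (n : ℂ) / (Real.pi : ℂ)) ^ m *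
        ∏ χ ∈ evenCharacters n, χ (4 : ZMod n) * (mulPsi χ).LFunction 1 := by
  classical
  have := Fintype.ofFinite (UnitsModSign n)
  have hcard : (evenCharacters n).card = m := by
    have := card_evenCharacters_mul_two (n := n) hn
    omega
  have h4 : IsUnit (4 : ZMod n) := by
    have := (ZMod.isUnit_iff_coprime 4 n).mpr
      (Nat.Coprime.pow_left 2 (Nat.coprime_two_left.mpr hodd) :)
    exact_mod_cast this
  have hn0 : (n : ℂ) ≠ 0 := by exact_mod_cast NeZero.ne n
  have hpi : (Real.pi : ℂ) ≠ 0 := by exact_mod_cast Real.pi_ne_zero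
  obtain ⟨k, hk⟩ := hodd
  have hexp : (n - 1) * m / 2 = (n - 1) / 2 * m := by
    rw [hk, Nat.add_sub_cancel, mul_assoc, Nat.mul_div_cancel_left _ two_pos,
      Nat.mul_div_cancel_left _ two_pos]
  have hsign : ((-1 : ℂ) ^ ((n - 1) / 2)) * (-1) ^ ((n - 1) / 2) = 1 := by
    rw [← mul_pow]
    simp
  -- `χ 4` times the `L`-value, up to the factor `χ 4 ^ 2`, is the eigenvalue attached to `χ`.
  have hL : ∀ χ : {χ // χ ∈ evenCharacters n}, χ.1 4 * (mulPsi χ.1).LFunction 1 =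
      (Real.pi / (2 * n) * (-1) ^ ((n - 1) / 2)) * (χ.1 4 * χ.1 4) *
        ∑ g, UnitsModSign.liftEven χ.1 (mem_evenCharacters.mp χ.2) g *
          (UnitsModSign.secant g : ℂ) := by
    intro χ
    rw [mulPsi_LFunction_one ⟨k, hk⟩ (mem_evenCharacters.mp χ.2),
      sum_mul_realSec_eq hn χ.1 (mem_evenCharacters.mp χ.2)]
    field_simp
    ring
  have hprod4 : ∏ χ : {χ // χ ∈ evenCharacters n}, (χ.1 4 * χ.1 4) = 1 := by
    rw [Finset.prod_coe_sort (evenCharacters n) fun χ => χ 4 * χ 4, Finset.prod_mul_distrib,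
      prod_evenCharacters_mul_self_eq_one h4]
  rw [secMatrix_det_eq hn ⟨k, hk⟩, secSign_eq_sign hn ⟨k, hk⟩,
    ← Finset.prod_coe_sort (evenCharacters n) fun χ => χ 4 * (mulPsi χ).LFunction 1,
    Finset.prod_congr rfl fun χ _ => hL χ, Finset.prod_mul_distrib, Finset.prod_mul_distrib,
    hprod4, Finset.prod_const, Finset.card_univ, Fintype.card_coe, hcard, hexp, pow_mul, mul_one]
  have hscal : ((-1 : ℂ) ^ ((n - 1) / 2)) ^ m * (2 * n / Real.pi) ^ m *
      (Real.pi / (2 * n) * (-1) ^ ((n - 1) / 2)) ^ m = 1 := by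
    rw [← mul_pow, ← mul_pow]
    have : (-1 : ℂ) ^ ((n - 1) / 2) * (2 * n / Real.pi) *
        (Real.pi / (2 * n) * (-1) ^ ((n - 1) / 2)) = 1 := by
      have hcancel : (2 * n / Real.pi : ℂ) * (Real.pi / (2 * n)) = 1 := by field_simp
      linear_combination (-1 : ℂ) ^ ((n - 1) / 2) * (-1) ^ ((n - 1) / 2) * hcancel + hsign
    rw [this, one_pow]
  rw [mul_assoc, mul_assoc, ← mul_assoc ((2 * (n : ℂ) / Real.pi) ^ m), ← mul_assoc (_ ^ m),
    ← mul_assoc (_ ^ m) (_ ^ m), hscal, one_mul]
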